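/- **Proposition 5.** Let $(X,d)$ be a compact metric space, $x_0\in X$, and let $P(X)$ be the set of Borel probability measures on $X$. Let $\mathrm{Lip}(X)$ be the set of Lipschitz functions $f:X\to\mathbb R$, $\|f\|_L=\sup_{x\ne y}|f(x)-f(y)|/d(x,y)$ (with $\sup\emptyset=0$), and $\mathrm{Lip}(X,x_0)=\{f\in\mathrm{Lip}(X): f(x_0)=0\}$. Let $W_1(\mu,\xi)=\inf_\pi\int d\,d\pi$ be the Wasserstein-1 distance, the infimum being over all couplings $\pi$ of $\mu$ and $\xi$. Let $\phi:\mathbb R\to\mathbb R\cup\{+\infty\}$ be proper, convex and lower semicontinuous, strictly convex at $1$, with $\phi(1)=0$ and $1$ in the relative interior of $\operatorname{dom}\phi=\{\phi<\infty\}$; here strict convexity at $1$ means that $t\phi(x_1)+(1-t)\phi(x_2)>\phi(1)$ whenever $t\in(0,1)$, $x_1,x_2\in\operatorname{dom}\phi$ and $tx_1+(1-t)x_2=1$, unless $x_1=x_2=1$. For $\xi,\nu\in P(X)$ with Lebesgue decomposition $\xi=\xi_c+\xi_s$, $\xi_c\ll\nu$, $\xi_s\perp\nu$, put $$D_\phi(\xi\Vert\nu)=\int\phi\Big(\frac{d\xi_c}{d\nu}\Big)d\nu+\phi'(\infty)\,\xi_s(X),\qquad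 \phi'(\infty)=\lim_{x\to\infty}\frac{\phi(x)}{x}$$ (with $\infty\cdot 0=0$), and $D_\phi^*(f\Vert\nu)=\sup_{\xi\in P(X)}\{\int f\,d\xi-D_\phi(\xi\Vert\nu)\}$ for $f\in\mathrm{Lip}(X)$. A function $f\in\mathrm{Lip}(X)$ is a *Csiszár potential* of $(\xi,\nu)$ if $D_\phi(\xi\Vert\nu)=\int f\,d\xi-D_\phi^*(f\Vert\nu)$, and a *Kantorovich potential* of $(\mu,\xi)$ if $\|f\|_L\le1$ and $W_1(\mu,\xi)=\int f\,d\mu-\int f\,d\xi$. Let $\mu,\nu\in P(X)$, $\lambda>0$, $\alpha\ge1$, and let $\xi_*\in P(X)$ attain the minimum in $$D_{\phi,\lambda,\alpha}(\mu\Vert\nu)=\min_{\xi\in P(X)}\{D_\phi(\xi\Vert\nu)+\lambda W_1(\mu,\xi)^\alpha\}.$$ Then there is $f_*\in\mathrm{Lip}(X,x_0)$ that attains the maximum in the dual formula $$D_{\phi,\lambda,1}(\mu\Vert\nu)=\max_{f\in\mathrm{Lip}(X,x_0),\ \|f\|_L\le\lambda}\Big\{\int f\,d\mu-D_\phi^*(f\Vert\nu)\Big\}$$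 if $\alpha=1$, respectively $$D_{\phi,\lambda,\alpha}(\mu\Vert\nu)=\max_{f\in\mathrm{Lip}(X,x_0)}\Big\{\int f\,d\mu-D_\phi^*(f\Vert\nu)-(\alpha-1)\alpha^{\frac{\alpha}{1-\alpha}}\lambda^{\frac1{1-\alpha}}\|f\|_L^{\frac{\alpha}{\alpha-1}}\Big\}$$ if $\alpha>1$, and that is at the same time a Csiszár potential of $(\xi_*,\nu)$ and $\alpha\lambda W_1(\mu,\xi_*)^{\alpha-1}$ times a Kantorovich potential of $(\mu,\xi_*)$ (where $0^0=1$). Moreover, if $\alpha>1$ or $\xi_*\neq\mu$, then $\|f_*\|_L=\alpha\lambda W_1(\mu,\xi_*)^{\alpha-1}$. -/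

import Mathlib

open MeasureTheory Filter Topology
open scoped ENNReal NNReal

namespace MoreauYosida

noncomputable section

/-! ### Extended-real convex functions on the line -/

/-- The effective domain of an extended-real-valued function. -/
def effDom (φ : ℝ → EReal) : Set ℝ := {x | φ x < ⊤}

/-- `φ` is proper: its effective domain is nonempty and it never takes the value `-∞`. -/
def IsProper (φ : ℝ → EReal) : Prop := (effDom φ).Nonempty ∧ ∀ x, φ x ≠ ⊥

/-- Convexity of an extended-real-valued function. -/
def IsConvex (φ : ℝ → EReal) : Prop :=
  ∀ x y t : ℝ, 0 ≤ t → t ≤ 1 →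
    φ (t * x + (1 - t) * y) ≤ (t : EReal) * φ x + ((1 - t : ℝ) : EReal) * φ y

/-- `φ` is strictly convex at the point `x₀`. -/
def IsStrictlyConvexAt (φ : ℝ → EReal) (x₀ : ℝ) : Prop :=
  ∀ x₁ ∈ effDom φ, ∀ x₂ ∈ effDom φ, ∀ t : ℝ, 0 < t → t < 1 →
    t * x₁ + (1 - t) * x₂ = x₀ → ¬ (x₁ = x₀ ∧ x₂ = x₀) →
    φ x₀ < (t : EReal) * φ x₁ + ((1 - t : ℝ) : EReal) * φ x₂

/-- The standing assumptions on the function generating the divergence: proper, convex, lower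
semicontinuous, strictly convex at `1`, `φ 1 = 0`, and `1` lies in the relative interior of the
effective domain. -/
structure IsDivergenceFunction (φ : ℝ → EReal) : Prop where
  proper : IsProper φ
  convex : IsConvex φ
  lsc : LowerSemicontinuous φ
  strictlyConvexAt_one : IsStrictlyConvexAt φ 1
  map_one : φ 1 = 0
  one_mem_relint : (1 : ℝ) ∈ intrinsicInterior ℝ (effDom φ)

/-- The recession slope `φ'(∞) = lim_{x → ∞} φ x / x`. For the functions `φ` considered here this
limit exists in the extended reals, and then it is equal to the upper limit. -/
def slopeAtTop (φ : ℝ → EReal) : EReal := limsup (fun x : ℝ => φ x / (x : EReal)) atTop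

/-! ### Divergences -/

variable {X : Type*} [MeasurableSpace X]

/-- The integral of an extended-real-valued function, `∫ g⁺ - ∫ g⁻`. -/
def integralEReal (g : X → EReal) (ν : Measure X) : EReal :=
  ((∫⁻ x, (g x).toENNReal ∂ν : ℝ≥0∞) : EReal) - ((∫⁻ x, (-g x).toENNReal ∂ν : ℝ≥0∞) : EReal)

/-- The divergence `D_φ(ξ ‖ ν)` of probability measures,
`∫ φ(dξ_c/dν) dν + φ'(∞) ξ_s(X)`, where `ξ = ξ_c + ξ_s` is the Lebesgue decomposition with respect
to `ν` (the singular part is nonnegative, so its negative part does not contribute). -/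
def divergence (φ : ℝ → EReal) (ξ ν : ProbabilityMeasure X) : EReal :=
  integralEReal (fun x => φ (((ξ : Measure X).rnDeriv ν x).toReal)) (ν : Measure X)
    + slopeAtTop φ * (((ξ : Measure X).singularPart ν Set.univ : ℝ≥0∞) : EReal)

/-- The tight convex conjugate
`D_φ^*(f ‖ ν) = sup_{ξ ∈ P(X)} (∫ f dξ - D_φ(ξ ‖ ν))`. -/
def tightConjugate (φ : ℝ → EReal) (ν : ProbabilityMeasure X) (f : X → ℝ) : EReal :=
  ⨆ ξ : ProbabilityMeasure X, ((∫ x, f x ∂(ξ : Measure X) : ℝ) : EReal) - divergence φ ξ ν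

/-! ### Lipschitz functions and the Wasserstein distance -/

variable [MetricSpace X]

/-- `f` is Lipschitz continuous (with some constant). -/
def IsLip (f : X → ℝ) : Prop := ∃ K : ℝ≥0, LipschitzWith K f

/-- The Lipschitz norm `‖f‖_L = sup_{x ≠ y} |f x - f y| / d(x, y)` of a Lipschitz function
(equal to `0` when `X` has only one point). -/
def lipNorm (f : X → ℝ) : ℝ :=
  sSup {r : ℝ | ∃ x y : X, x ≠ y ∧ r = |f x - f y| / dist x y}

/-- `π` is a coupling of `μ` and `ν`. -/
def IsCoupling (μ ν : ProbabilityMeasure X) (π : ProbabilityMeasure (X × X)) : Prop :=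
  (π : Measure (X × X)).map Prod.fst = (μ : Measure X) ∧
    (π : Measure (X × X)).map Prod.snd = (ν : Measure X)

/-- The Wasserstein-1 distance
`W₁(μ, ν) = inf_π ∫ d(x₁, x₂) dπ(x₁, x₂)` over all couplings `π` of `μ` and `ν`. -/
def W1 (μ ν : ProbabilityMeasure X) : ℝ :=
  sInf {r : ℝ | ∃ π : ProbabilityMeasure (X × X), IsCoupling μ ν π ∧
    r = ∫ p, dist p.1 p.2 ∂(π : Measure (X × X))}

/-- `f` is a Csiszár potential of `(ξ, ν)`: a Lipschitz function with
`D_φ(ξ ‖ ν) = ∫ f dξ - D_φ^*(f ‖ ν)`. -/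
def IsCsiszarPotential (φ : ℝ → EReal) (ξ ν : ProbabilityMeasure X) (f : X → ℝ) : Prop :=
  IsLip f ∧
    divergence φ ξ ν = ((∫ x, f x ∂(ξ : Measure X) : ℝ) : EReal) - tightConjugate φ ν f

/-- `f` is a Kantorovich potential of `(μ, ξ)`: `‖f‖_L ≤ 1` and
`W₁(μ, ξ) = ∫ f dμ - ∫ f dξ`. -/
def IsKantorovichPotential (μ ξ : ProbabilityMeasure X) (f : X → ℝ) : Prop :=
  IsLip f ∧ lipNorm f ≤ 1 ∧
    W1 μ ξ = ∫ x, f x ∂(μ : Measure X) - ∫ x, f x ∂(ξ : Measure X)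

/-! ### Moreau–Yosida approximation -/

/-- The objective `ξ ↦ D_φ(ξ ‖ ν) + lam * W₁(μ, ξ) ^ α` of the primal problem. -/
def primalObjective (φ : ℝ → EReal) (lam α : ℝ) (μ ν ξ : ProbabilityMeasure X) : EReal :=
  divergence φ ξ ν + ((lam * W1 μ ξ ^ α : ℝ) : EReal)

/-- The Moreau–Yosida approximation `D_{φ,lam,α}(μ ‖ ν)` of index `lam` and order `α`. -/
def moreauYosida (φ : ℝ → EReal) (lam α : ℝ) (μ ν : ProbabilityMeasure X) : EReal :=
  ⨅ ξ : ProbabilityMeasure X, primalObjective φ lam α μ ν ξ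

/-- The space `Lip(X, x₀)` of Lipschitz functions vanishing at `x₀`. -/
def LipAt (x₀ : X) : Set (X → ℝ) := {f | IsLip f ∧ f x₀ = 0}

/-- The admissible functions in the dual problem of order `α`: those in `Lip(X, x₀)`, with the
constraint `‖f‖_L ≤ lam` if `α = 1`. -/
def dualFeasible (lam α : ℝ) (x₀ : X) : Set (X → ℝ) :=
  {f | f ∈ LipAt x₀ ∧ (α = 1 → lipNorm f ≤ lam)}

open Classical in
/-- The objective of the dual problem of order `α ≥ 1`: `∫ f dμ - D_φ^*(f ‖ ν)` if `α = 1`, and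
`∫ f dμ - D_φ^*(f ‖ ν) - (α-1) α^{α/(1-α)} lam^{1/(1-α)} ‖f‖_L^{α/(α-1)}` if `α > 1`. -/
def dualObjective (φ : ℝ → EReal) (lam α : ℝ) (μ ν : ProbabilityMeasure X) (f : X → ℝ) : EReal :=
  if α = 1 then
    ((∫ x, f x ∂(μ : Measure X) : ℝ) : EReal) - tightConjugate φ ν f
  else
    ((∫ x, f x ∂(μ : Measure X) : ℝ) : EReal) - tightConjugate φ ν f
      - (((α - 1) * α ^ (α / (1 - α)) * lam ^ (1 / (1 - α))
          * lipNorm f ^ (α / (α - 1)) : ℝ) : EReal)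

end

end MoreauYosida

/-!
A minimizer `ξ` of the convex function `D_φ(· ‖ ν) + lam * W₁(μ, ·) ^ α` also minimizes its
linearization `D_φ(· ‖ ν) + c * W₁(μ, ·)` at `ξ`, with `c = α * lam * W₁(μ, ξ) ^ (α - 1)`. By
Kantorovich duality `c * W₁(μ, η)` is the supremum of `∫ f dμ - ∫ f dη` over the `c`-Lipschitz
functions `f` vanishing at `x₀`. These form a compact convex set, so the minimum over `η` and the
supremum over `f` may be exchanged, and one `f` attains the supremum for all `η` simultaneously:
`D_φ(ξ ‖ ν) + c * W₁(μ, ξ) ≤ D_φ(η ‖ ν) + ∫ f dμ - ∫ f dη`.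
Taking `η = ξ` shows that `f` is `c` times a Kantorovich potential, and what then remains is that
`f` is a Csiszár potential. Young's inequality, with equality at slope `c`, converts the linearized
problem into the dual one.
-/

namespace MoreauYosida

noncomputable section

section Minimax

variable {E : Type*} [NormedAddCommGroup E] [NormedSpace ℝ E]

theorem exists_mem_forall_apply_le {K : Set E} (hK : IsCompact K) (hKc : Convex ℝ K)
    (hne : K.Nonempty) {A : Set (StrongDual ℝ E × ℝ)} (hA : Convex ℝ A)
    (h : ∀ a ∈ A, ∃ x ∈ K, a.1 x ≤ a.2) : ∃ x ∈ K, ∀ a ∈ A, a.1 x ≤ a.2 := by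
  by_contra! hcon
  have hclosed (a : A) : IsClosed {x : E | a.1.1 x ≤ a.1.2} :=
    isClosed_le (by fun_prop) continuous_const
  obtain ⟨s, hs⟩ := hK.elim_finite_subfamily_closed _ hclosed <| by
    refine Set.eq_empty_of_forall_notMem fun x ⟨hx, hxA⟩ => ?_
    obtain ⟨a, ha, hax⟩ := hcon x hx
    exact hax.not_ge (Set.mem_iInter.1 hxA ⟨a, ha⟩)
  let excessAt (x : E) : StrongDual ℝ E × ℝ →L[ℝ] ℝ :=
    (ContinuousLinearMap.apply ℝ ℝ x).comp (.fst ℝ _ ℝ) - .snd ℝ _ ℝ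
  obtain ⟨a, ha, hpos⟩ := Sion.exists_lt_iInf_of_lt_iInf_of_finite (X := K) (Y := A)
    (f := fun x a => a.1 x - a.2) (t := 0) (s := Subtype.val '' (s : Set A)) hne hK
    (fun a _ => Continuous.lowerSemicontinuous (by fun_prop) |>.lowerSemicontinuousOn K)
    (fun a _ => ((a.1.toLinearMap.convexOn hKc).sub (concaveOn_const _ hKc)).quasiconvexOn) hA
    (fun x _ => Continuous.upperSemicontinuous (by fun_prop) |>.upperSemicontinuousOn A)
    (fun x _ => (excessAt x).toLinearMap.concaveOn hA |>.quasiconcaveOn) hKc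
    (Set.toFinite _) (Subtype.coe_image_subset A _) fun x hx => by
      by_contra! hle
      refine Set.eq_empty_iff_forall_notMem.1 hs x ⟨hx, Set.mem_iInter₂.2 fun a ha => ?_⟩
      exact sub_nonpos.1 (hle a ⟨a, ha, rfl⟩)
  obtain ⟨x, hx, hle⟩ := h a ha
  exact (hpos x hx).not_ge (sub_nonpos.2 hle)

end Minimax

section LipBall

open BoundedContinuousFunction

variable {X : Type*} [MetricSpace X]

/-- The functions with Lipschitz constant `c` vanishing at `x₀`, as a set of bounded continuous
functions. -/
def lipBall (x₀ : X) (c : ℝ≥0) : Set (X →ᵇ ℝ) :=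
  {f | f x₀ = 0 ∧ LipschitzWith c f}

theorem zero_mem_lipBall (x₀ : X) (c : ℝ≥0) : (0 : X →ᵇ ℝ) ∈ lipBall x₀ c :=
  ⟨rfl, LipschitzWith.const' 0⟩

theorem smul_mem_lipBall {x₀ : X} {c : ℝ≥0} {f : X →ᵇ ℝ} (hf : f ∈ lipBall x₀ c) (s : ℝ) :
    s • f ∈ lipBall x₀ (‖s‖₊ * c) :=
  ⟨by simp [hf.1], (lipschitzWith_smul s).comp hf.2⟩

theorem isClosed_lipBall (x₀ : X) (c : ℝ≥0) : IsClosed (lipBall x₀ c) := by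
  have hlip : IsClosed ((fun f : X →ᵇ ℝ => (f : X → ℝ)) ⁻¹' {f | LipschitzWith c f}) :=
    (isClosed_setOfPred_lipschitzWith c).preimage continuous_coe
  exact (isClosed_eq (continuous_eval_const x₀) continuous_const).inter hlip

theorem convex_lipBall (x₀ : X) (c : ℝ≥0) : Convex ℝ (lipBall x₀ c) := by
  rintro f ⟨hf₀, hf⟩ g ⟨hg₀, hg⟩ a b ha hb hab
  refine ⟨by simp [hf₀, hg₀], LipschitzWith.of_dist_le_mul fun x y => ?_⟩
  calc dist (a • f x + b • g x) (a • f y + b • g y)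
      ≤ dist (a • f x) (a • f y) + dist (b • g x) (b • g y) := dist_add_add_le _ _ _ _
    _ = a * dist (f x) (f y) + b * dist (g x) (g y) := by
        rw [dist_smul₀, dist_smul₀, Real.norm_of_nonneg ha, Real.norm_of_nonneg hb]
    _ ≤ a * (c * dist x y) + b * (c * dist x y) := by
        gcongr
        exacts [hf.dist_le_mul x y, hg.dist_le_mul x y]
    _ = c * dist x y := by rw [← add_mul, hab, one_mul]

theorem isCompact_lipBall [CompactSpace X] (x₀ : X) (c : ℝ≥0) : IsCompact (lipBall x₀ c) := by
  refine arzela_ascoli₂ (Metric.closedBall (0 : ℝ) (c * Metric.diam (Set.univ : Set X)))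
    (isCompact_closedBall _ _) _ (isClosed_lipBall x₀ c) ?_ ?_
  · rintro f x ⟨hf₀, hf⟩
    calc dist (f x) 0 = dist (f x) (f x₀) := by rw [hf₀]
      _ ≤ c * dist x x₀ := hf.dist_le_mul x x₀
      _ ≤ c * Metric.diam Set.univ := by
        gcongr
        exact Metric.dist_le_diam_of_mem isCompact_univ.isBounded (Set.mem_univ _) (Set.mem_univ _)
  · exact (LipschitzWith.uniformEquicontinuous _ c fun f => f.2.2).equicontinuous

theorem lipNorm_nonneg (f : X → ℝ) : 0 ≤ lipNorm f :=
  Real.sSup_nonneg (by rintro r ⟨x, y, -, rfl⟩; positivity)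

theorem lipNorm_le_of_lipschitzWith {f : X → ℝ} {c : ℝ≥0} (hf : LipschitzWith c f) :
    lipNorm f ≤ c := by
  refine Real.sSup_le ?_ c.coe_nonneg
  rintro r ⟨x, y, hxy, rfl⟩
  exact (div_le_iff₀ (dist_pos.2 hxy)).2 (hf.dist_le_mul x y)

theorem IsLip.lipschitzWith_lipNorm {f : X → ℝ} (hf : IsLip f) :
    LipschitzWith (lipNorm f).toNNReal f := by
  obtain ⟨c, hc⟩ := hf
  refine LipschitzWith.of_dist_le_mul fun x y => ?_
  rcases eq_or_ne x y with rfl | hxy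
  · simp
  rw [Real.coe_toNNReal _ (lipNorm_nonneg f), ← div_le_iff₀ (dist_pos.2 hxy)]
  refine le_csSup ⟨c, ?_⟩ ⟨x, y, hxy, rfl⟩
  rintro r ⟨x, y, hxy, rfl⟩
  exact (div_le_iff₀ (dist_pos.2 hxy)).2 (hc.dist_le_mul x y)

end LipBall

section Mix

variable {X : Type*} [MeasurableSpace X]

/-- The mixture `a ξ₁ + b ξ₂` of two probability measures, with weights `a + b = 1`. -/
def mix (a b : ℝ≥0) (hab : a + b = 1) (ξ₁ ξ₂ : ProbabilityMeasure X) : ProbabilityMeasure X :=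
  ⟨a • (ξ₁ : Measure X) + b • (ξ₂ : Measure X), ⟨by
    simp only [Measure.coe_add, Measure.coe_nnreal_smul_apply, Pi.add_apply, measure_univ, mul_one]
    exact_mod_cast hab⟩⟩

theorem coe_mix (a b : ℝ≥0) (hab : a + b = 1) (ξ₁ ξ₂ : ProbabilityMeasure X) :
    (mix a b hab ξ₁ ξ₂ : Measure X) = a • (ξ₁ : Measure X) + b • (ξ₂ : Measure X) := rfl

theorem integral_mix (a b : ℝ≥0) (hab : a + b = 1) {ξ₁ ξ₂ : ProbabilityMeasure X} {f : X → ℝ}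
    (h₁ : Integrable f (ξ₁ : Measure X)) (h₂ : Integrable f (ξ₂ : Measure X)) :
    ∫ x, f x ∂(mix a b hab ξ₁ ξ₂ : Measure X) =
      a * ∫ x, f x ∂(ξ₁ : Measure X) + b * ∫ x, f x ∂(ξ₂ : Measure X) := by
  rw [coe_mix, integral_add_measure h₁.smul_measure_nnreal h₂.smul_measure_nnreal,
    integral_smul_nnreal_measure, integral_smul_nnreal_measure]
  simp only [NNReal.smul_def, smul_eq_mul]

end Mix

section Integral

open BoundedContinuousFunction

variable {X : Type*} [TopologicalSpace X] [MeasurableSpace X] [OpensMeasurableSpace X]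

theorem integrable_of_continuous [CompactSpace X] {f : X → ℝ} (hf : Continuous f) (ξ : Measure X)
    [IsFiniteMeasure ξ] : Integrable f ξ :=
  (BoundedContinuousFunction.mkOfCompact ⟨f, hf⟩).integrable ξ

/-- Integration of bounded continuous functions against a probability measure, as a continuous
linear functional. -/
def integralCLM (η : ProbabilityMeasure X) : StrongDual ℝ (X →ᵇ ℝ) :=
  LinearMap.mkContinuous
    { toFun := fun f => ∫ x, f x ∂(η : Measure X)
      map_add' := fun f g => integral_add (f.integrable _) (g.integrable _)
      map_smul' := fun c f => integral_const_mul c _ }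
    1 fun f => by simpa using f.norm_integral_le_norm (η : Measure X)

@[simp]
theorem integralCLM_apply (η : ProbabilityMeasure X) (f : X →ᵇ ℝ) :
    integralCLM η f = ∫ x, f x ∂(η : Measure X) := rfl

theorem integralCLM_mix (a b : ℝ≥0) (hab : a + b = 1) (ξ₁ ξ₂ : ProbabilityMeasure X) :
    integralCLM (mix a b hab ξ₁ ξ₂) = (a : ℝ) • integralCLM ξ₁ + (b : ℝ) • integralCLM ξ₂ := by
  ext f
  exact integral_mix a b hab (f.integrable _) (f.integrable _)

end Integral

section Coupling

variable {X : Type*} [MeasurableSpace X] {μ ξ : ProbabilityMeasure X}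

theorem exists_isCoupling (μ ξ : ProbabilityMeasure X) :
    ∃ π : ProbabilityMeasure (X × X), IsCoupling μ ξ π :=
  ⟨⟨(μ : Measure X).prod (ξ : Measure X), inferInstance⟩, by simp, by simp⟩

theorem IsCoupling.measurePreserving_fst {π : ProbabilityMeasure (X × X)} (hπ : IsCoupling μ ξ π) :
    MeasurePreserving Prod.fst (π : Measure (X × X)) (μ : Measure X) :=
  ⟨measurable_fst, hπ.1⟩

theorem IsCoupling.measurePreserving_snd {π : ProbabilityMeasure (X × X)} (hπ : IsCoupling μ ξ π) :
    MeasurePreserving Prod.snd (π : Measure (X × X)) (ξ : Measure X) :=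
  ⟨measurable_snd, hπ.2⟩

theorem IsCoupling.integral_add {π : ProbabilityMeasure (X × X)} (hπ : IsCoupling μ ξ π)
    {g h : X → ℝ} (hg : Integrable g (μ : Measure X)) (hh : Integrable h (ξ : Measure X)) :
    ∫ p, (g p.1 + h p.2) ∂(π : Measure (X × X)) =
      ∫ x, g x ∂(μ : Measure X) + ∫ x, h x ∂(ξ : Measure X) := by
  calc ∫ p, (g p.1 + h p.2) ∂(π : Measure (X × X))
      = ∫ p, g p.1 ∂(π : Measure (X × X)) + ∫ p, h p.2 ∂(π : Measure (X × X)) :=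
        MeasureTheory.integral_add (hπ.measurePreserving_fst.integrable_comp_of_integrable hg)
          (hπ.measurePreserving_snd.integrable_comp_of_integrable hh)
    _ = ∫ x, g x ∂(μ : Measure X) + ∫ x, h x ∂(ξ : Measure X) := by
        rw [← hπ.1, ← hπ.2, integral_map measurable_fst.aemeasurable
          (hπ.1.symm ▸ hg.aestronglyMeasurable), integral_map measurable_snd.aemeasurable
          (hπ.2.symm ▸ hh.aestronglyMeasurable)]

variable [MetricSpace X]

theorem W1_nonneg (μ ξ : ProbabilityMeasure X) : 0 ≤ W1 μ ξ :=
  Real.sInf_nonneg (by rintro r ⟨π, -, rfl⟩; exact integral_nonneg fun _ => dist_nonneg)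

theorem IsCoupling.W1_le {π : ProbabilityMeasure (X × X)} (hπ : IsCoupling μ ξ π) :
    W1 μ ξ ≤ ∫ p, dist p.1 p.2 ∂(π : Measure (X × X)) :=
  csInf_le ⟨0, by rintro r ⟨π, -, rfl⟩; exact integral_nonneg fun _ => dist_nonneg⟩ ⟨π, hπ, rfl⟩

variable [BorelSpace X] [CompactSpace X]

theorem integral_sub_le_mul_W1 (μ ξ : ProbabilityMeasure X) {f : X → ℝ} {c : ℝ≥0}
    (hf : LipschitzWith c f) :
    ∫ x, f x ∂(μ : Measure X) - ∫ x, f x ∂(ξ : Measure X) ≤ c * W1 μ ξ := by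
  have hint := integrable_of_continuous hf.continuous
  rw [W1, ← smul_eq_mul (c : ℝ), ← Real.sInf_smul_of_nonneg c.coe_nonneg]
  obtain ⟨π₀, hπ₀⟩ := exists_isCoupling μ ξ
  refine le_csInf (Set.Nonempty.smul_set ⟨_, π₀, hπ₀, rfl⟩) ?_
  rintro _ ⟨_, ⟨π, hπ, rfl⟩, rfl⟩
  calc ∫ x, f x ∂(μ : Measure X) - ∫ x, f x ∂(ξ : Measure X)
      = ∫ p, (f p.1 + -f p.2) ∂(π : Measure (X × X)) := by
        rw [hπ.integral_add (h := fun x => -f x) (hint _) (hint _).neg, integral_neg,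
          sub_eq_add_neg]
    _ ≤ ∫ p, c * dist p.1 p.2 ∂(π : Measure (X × X)) := by
        have hcont := hf.continuous
        refine integral_mono (integrable_of_continuous (by fun_prop) _)
          (integrable_of_continuous (by fun_prop) _) fun p => ?_
        exact (sub_eq_add_neg (f p.1) _).symm.trans_le
          ((le_abs_self _).trans (hf.dist_le_mul p.1 p.2))
    _ = (c : ℝ) • ∫ p, dist p.1 p.2 ∂(π : Measure (X × X)) := integral_const_mul _ _

theorem eq_of_W1_eq_zero (h : W1 μ ξ = 0) : μ = ξ := by
  have hle (f : X → ℝ) (c : ℝ≥0) (hf : LipschitzWith c f) :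
      ∫ x, f x ∂(μ : Measure X) ≤ ∫ x, f x ∂(ξ : Measure X) := by
    simpa [h] using integral_sub_le_mul_W1 μ ξ hf
  have hconst : Tendsto (fun _ : ℕ => μ) atTop (𝓝 ξ) := by
    refine tendsto_iff_forall_lipschitz_integral_tendsto.2 fun f _ ⟨c, hf⟩ => ?_
    have hneg := hle (-f) c hf.neg
    simp only [Pi.neg_apply, integral_neg, neg_le_neg_iff] at hneg
    rw [(hle f c hf).antisymm hneg]
    exact tendsto_const_nhds
  exact tendsto_nhds_unique tendsto_const_nhds hconst

end Coupling

section Duality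

theorem exists_linearMap_eq_and_forall_le_of_sublinear {E : Type*} [AddCommGroup E] [Module ℝ E]
    (N : E → ℝ) (hsmul : ∀ c : ℝ, 0 < c → ∀ x, N (c • x) = c * N x)
    (hadd : ∀ x y, N (x + y) ≤ N x + N y) (x₀ : E) :
    ∃ L : E →ₗ[ℝ] ℝ, L x₀ = N x₀ ∧ ∀ x, L x ≤ N x := by
  have hzero : N 0 = 0 := by linarith [hsmul 2 two_pos 0, congrArg N (smul_zero (2 : ℝ) (A := E))]
  have hker (c : ℝ) (hc : c • x₀ = 0) : c • N x₀ = 0 := by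
    rcases smul_eq_zero.1 hc with rfl | rfl
    · exact zero_smul ℝ _
    · rw [hzero, smul_zero]
  have hline (c : ℝ) : c * N x₀ ≤ N (c • x₀) := by
    rcases lt_trichotomy c 0 with hc | rfl | hc
    · have hcancel := hadd (c • x₀) (-c • x₀)
      rw [neg_smul, add_neg_cancel, hzero, ← neg_smul, hsmul _ (neg_pos.2 hc)] at hcancel
      linarith
    · simp [hzero]
    · exact (hsmul c hc x₀).ge
  obtain ⟨L, hext, hle⟩ := exists_extension_of_le_sublinear
    (LinearPMap.mkSpanSingleton' x₀ (N x₀) hker) N hsmul hadd <| by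
      rintro ⟨_, hx⟩
      obtain ⟨c, rfl⟩ := Submodule.mem_span_singleton.1 hx
      exact (LinearPMap.mkSpanSingleton'_apply _ _ hker c hx).trans_le (hline c)
  refine ⟨L, ?_, hle⟩
  have hx₀ := Submodule.mem_span_singleton_self (R := ℝ) x₀
  exact (hext ⟨x₀, hx₀⟩).trans (LinearPMap.mkSpanSingleton'_apply_self _ _ hker hx₀)

theorem exists_isFiniteMeasure_forall_integral_eq {Y : Type*} [TopologicalSpace Y] [T2Space Y]
    [CompactSpace Y] [MeasurableSpace Y] [BorelSpace Y] (L : C(Y, ℝ) →ₗ[ℝ] ℝ)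
    (hL : ∀ F, 0 ≤ F → 0 ≤ L F) :
    ∃ m : Measure Y, IsFiniteMeasure m ∧ ∀ F : C(Y, ℝ), ∫ y, F y ∂m = L F := by
  let Λ : CompactlySupportedContinuousMap Y ℝ →ₚ[ℝ] ℝ := PositiveLinearMap.mk₀
    { toFun := fun F => L F.toContinuousMap
      map_add' := fun F G => L.map_add F.toContinuousMap G.toContinuousMap
      map_smul' := fun c F => L.map_smul c F.toContinuousMap }
    fun F hF => hL F.toContinuousMap hF
  exact ⟨RealRMK.rieszMeasure Λ, inferInstance, fun F => RealRMK.integral_rieszMeasure Λ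
    (CompactlySupportedContinuousMap.continuousMapEquiv F)⟩

variable {X : Type*} [MetricSpace X] [MeasurableSpace X]

theorem isCoupling_of_forall_integral_add [CompactSpace X] [BorelSpace X]
    {μ ξ : ProbabilityMeasure X} {π : ProbabilityMeasure (X × X)}
    (hπ : ∀ g h : C(X, ℝ), ∫ p, (g p.1 + h p.2) ∂(π : Measure (X × X)) =
      ∫ x, g x ∂(μ : Measure X) + ∫ x, h x ∂(ξ : Measure X)) : IsCoupling μ ξ π := by
  have := Measure.isProbabilityMeasure_map (μ := (π : Measure (X × X))) measurable_fst.aemeasurable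
  have := Measure.isProbabilityMeasure_map (μ := (π : Measure (X × X))) measurable_snd.aemeasurable
  constructor
  · refine ext_of_forall_integral_eq_of_IsFiniteMeasure fun g => ?_
    rw [integral_map measurable_fst.aemeasurable g.continuous.aestronglyMeasurable]
    simpa using hπ g.toContinuousMap 0
  · refine ext_of_forall_integral_eq_of_IsFiniteMeasure fun h => ?_
    rw [integral_map measurable_snd.aemeasurable h.continuous.aestronglyMeasurable]
    simpa using hπ 0 h.toContinuousMap

/-- The total prices `∫ g dμ + ∫ h dξ` of the continuous functions `g ⊕ h` dominating `F`. Their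
infimum is the dual value of the problem of maximizing `∫ F dπ` over the couplings `π`. -/
def dominatingPrices (μ ξ : ProbabilityMeasure X) (F : C(X × X, ℝ)) : Set ℝ :=
  {r | ∃ g h : C(X, ℝ), (∀ x y, F (x, y) ≤ g x + h y) ∧
    r = ∫ x, g x ∂(μ : Measure X) + ∫ x, h x ∂(ξ : Measure X)}

open scoped Pointwise

theorem smul_dominatingPrices_subset (μ ξ : ProbabilityMeasure X) {c : ℝ} (hc : 0 ≤ c)
    (F : C(X × X, ℝ)) : c • dominatingPrices μ ξ F ⊆ dominatingPrices μ ξ (c • F) := by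
  rintro _ ⟨_, ⟨g, h, hle, rfl⟩, rfl⟩
  refine ⟨c • g, c • h, fun x y => ?_, ?_⟩
  · simpa [mul_add] using mul_le_mul_of_nonneg_left (hle x y) hc
  · simp [integral_const_mul, mul_add]

theorem dominatingPrices_smul (μ ξ : ProbabilityMeasure X) {c : ℝ} (hc : 0 < c)
    (F : C(X × X, ℝ)) : dominatingPrices μ ξ (c • F) = c • dominatingPrices μ ξ F := by
  refine (smul_dominatingPrices_subset μ ξ hc.le F).antisymm' ?_
  rw [Set.subset_smul_set_iff₀ hc.ne']
  simpa [hc.ne'] using smul_dominatingPrices_subset μ ξ (inv_nonneg.2 hc.le) (c • F)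

variable [CompactSpace X]

theorem dominatingPrices_nonempty (μ ξ : ProbabilityMeasure X) (F : C(X × X, ℝ)) :
    (dominatingPrices μ ξ F).Nonempty :=
  ⟨_, ContinuousMap.const X ‖F‖, 0, fun x y => by
    simpa using (le_abs_self _).trans (F.norm_coe_le_norm (x, y)), rfl⟩

variable [BorelSpace X]

theorem dominatingPrices_add_subset (μ ξ : ProbabilityMeasure X) (F G : C(X × X, ℝ)) :
    dominatingPrices μ ξ F + dominatingPrices μ ξ G ⊆ dominatingPrices μ ξ (F + G) := by
  rintro _ ⟨_, ⟨g, h, hle, rfl⟩, _, ⟨g', h', hle', rfl⟩, rfl⟩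
  have hint := fun (k : C(X, ℝ)) => integrable_of_continuous k.continuous
  refine ⟨g + g', h + h', fun x y => ?_, ?_⟩
  · simp only [ContinuousMap.add_apply]
    linarith [hle x y, hle' x y]
  · simp only [ContinuousMap.add_apply]
    rw [integral_add (hint g _) (hint g' _), integral_add (hint h _) (hint h' _)]
    ring

theorem IsCoupling.integral_le_of_mem_dominatingPrices {μ ξ : ProbabilityMeasure X}
    {π : ProbabilityMeasure (X × X)} (hπ : IsCoupling μ ξ π) {F : C(X × X, ℝ)} {r : ℝ}
    (hr : r ∈ dominatingPrices μ ξ F) : ∫ p, F p ∂(π : Measure (X × X)) ≤ r := by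
  obtain ⟨g, h, hle, rfl⟩ := hr
  rw [← hπ.integral_add (integrable_of_continuous g.continuous _)
    (integrable_of_continuous h.continuous _)]
  exact integral_mono (integrable_of_continuous F.continuous _)
    (integrable_of_continuous (by fun_prop) _) fun p => hle p.1 p.2

theorem bddBelow_dominatingPrices (μ ξ : ProbabilityMeasure X) (F : C(X × X, ℝ)) :
    BddBelow (dominatingPrices μ ξ F) := by
  obtain ⟨π, hπ⟩ := exists_isCoupling μ ξ
  exact ⟨_, fun _ => hπ.integral_le_of_mem_dominatingPrices⟩

theorem exists_linearMap_eq_sInf_dominatingPrices (μ ξ : ProbabilityMeasure X)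
    (F : C(X × X, ℝ)) : ∃ L : C(X × X, ℝ) →ₗ[ℝ] ℝ, L F = sInf (dominatingPrices μ ξ F) ∧
      ∀ G, ∀ r ∈ dominatingPrices μ ξ G, L G ≤ r := by
  obtain ⟨L, hLF, hL⟩ := exists_linearMap_eq_and_forall_le_of_sublinear
    (fun G => sInf (dominatingPrices μ ξ G))
    (fun c hc G => by
      rw [dominatingPrices_smul μ ξ hc, Real.sInf_smul_of_nonneg hc.le, smul_eq_mul])
    (fun G H => by
      have hne := dominatingPrices_nonempty μ ξ
      have hbdd := bddBelow_dominatingPrices μ ξ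
      rw [← csInf_add (hne G) (hbdd G) (hne H) (hbdd H)]
      exact csInf_le_csInf (hbdd _) ((hne G).add (hne H)) (dominatingPrices_add_subset μ ξ G H)) F
  exact ⟨L, hLF, fun G r hr => (hL G).trans (csInf_le (bddBelow_dominatingPrices μ ξ G) hr)⟩

/-- **Kantorovich duality** for a continuous reward on a compact space. -/
theorem exists_isCoupling_integral_eq_sInf_dominatingPrices (μ ξ : ProbabilityMeasure X)
    (F : C(X × X, ℝ)) : ∃ π : ProbabilityMeasure (X × X), IsCoupling μ ξ π ∧
      ∫ p, F p ∂(π : Measure (X × X)) = sInf (dominatingPrices μ ξ F) := by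
  obtain ⟨L, hLF, hL⟩ := exists_linearMap_eq_sInf_dominatingPrices μ ξ F
  have hnonneg (G : C(X × X, ℝ)) (hG : 0 ≤ G) : 0 ≤ L G := by
    have hneg := hL (-G) 0 ⟨0, 0, fun x y => by simpa using hG (x, y), by simp⟩
    rwa [map_neg, neg_nonpos] at hneg
  have hsum (g h : C(X, ℝ)) : L (g.comp .fst + h.comp .snd) =
      ∫ x, g x ∂(μ : Measure X) + ∫ x, h x ∂(ξ : Measure X) := by
    refine (hL _ _ ⟨g, h, fun x y => le_rfl, rfl⟩).antisymm ?_
    have hneg := hL (-(g.comp .fst + h.comp .snd)) _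
      ⟨-g, -h, fun x y => by simp [add_comm], rfl⟩
    simp only [map_neg, ContinuousMap.neg_apply, integral_neg] at hneg
    linarith
  obtain ⟨m, _, hm⟩ := exists_isFiniteMeasure_forall_integral_eq L hnonneg
  have hprob : IsProbabilityMeasure m := by
    have hone := hsum 1 0
    rw [← hm] at hone
    simpa [isProbabilityMeasure_iff_real] using hone
  refine ⟨⟨m, hprob⟩, isCoupling_of_forall_integral_add fun g h => ?_, (hm F).trans hLF⟩
  exact (hm _).trans (hsum g h)

end Duality

section KantorovichRubinstein

open BoundedContinuousFunction

variable {X : Type*} [MetricSpace X]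

theorem lipschitzWith_one_of_forall_sub_le {u : X → ℝ} (hu : ∀ y z, u y - u z ≤ dist y z) :
    LipschitzWith 1 u :=
  LipschitzWith.of_dist_le_mul fun y z => by
    rw [Real.dist_eq, NNReal.coe_one, one_mul]
    exact abs_sub_le_iff.2 ⟨hu y z, dist_comm z y ▸ hu z y⟩

theorem exists_lipschitzWith_one_between [Nonempty X] {g h : X → ℝ}
    (hgh : ∀ x y, -dist x y ≤ g x + h y) :
    ∃ u : X → ℝ, LipschitzWith 1 u ∧ -h ≤ u ∧ u ≤ g := by
  have hbound (y x : X) : -h y ≤ g x + dist x y := by linarith [hgh x y]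
  have hbdd (y : X) : BddBelow (Set.range fun x => g x + dist x y) :=
    ⟨-h y, Set.forall_mem_range.2 (hbound y)⟩
  refine ⟨fun y => ⨅ x, g x + dist x y, lipschitzWith_one_of_forall_sub_le fun y z => ?_,
    fun y => le_ciInf (hbound y), fun y => (ciInf_le (hbdd y) y).trans (by simp)⟩
  rw [sub_le_comm]
  refine le_ciInf fun x => ?_
  have hinf : ⨅ x, g x + dist x y ≤ g x + dist x y := ciInf_le (hbdd y) x
  linarith [dist_triangle_right x y z, dist_comm y z]

variable [CompactSpace X] [MeasurableSpace X] [BorelSpace X]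

theorem exists_mem_lipBall_forall_integral_sub_le (x₀ : X) (μ ξ : ProbabilityMeasure X) :
    ∃ f ∈ lipBall x₀ 1, ∀ u : X → ℝ, LipschitzWith 1 u →
      ∫ x, u x ∂(μ : Measure X) - ∫ x, u x ∂(ξ : Measure X) ≤
        ∫ x, f x ∂(μ : Measure X) - ∫ x, f x ∂(ξ : Measure X) := by
  obtain ⟨f, hf, hmax⟩ := (isCompact_lipBall x₀ 1).exists_isMaxOn ⟨0, zero_mem_lipBall x₀ 1⟩
    (integralCLM μ - integralCLM ξ).continuous.continuousOn
  refine ⟨f, hf, fun u hu => ?_⟩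
  have hint := integrable_of_continuous hu.continuous
  let v : X →ᵇ ℝ := mkOfCompact ⟨fun x => u x - u x₀, hu.continuous.sub continuous_const⟩
  have hv : v ∈ lipBall x₀ 1 := ⟨sub_self _, LipschitzWith.of_dist_le_mul fun x y => by
    simpa [v] using hu.dist_le_mul x y⟩
  have hv_int (η : ProbabilityMeasure X) :
      ∫ x, v x ∂(η : Measure X) = ∫ x, u x ∂(η : Measure X) - u x₀ :=
    (integral_sub (hint _) (integrable_const _)).trans (by simp)
  calc ∫ x, u x ∂(μ : Measure X) - ∫ x, u x ∂(ξ : Measure X)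
      = ∫ x, v x ∂(μ : Measure X) - ∫ x, v x ∂(ξ : Measure X) := by rw [hv_int, hv_int]; ring
    _ ≤ ∫ x, f x ∂(μ : Measure X) - ∫ x, f x ∂(ξ : Measure X) := hmax hv

/-- **Kantorovich–Rubinstein duality**. -/
theorem exists_mem_lipBall_W1_eq (x₀ : X) (μ ξ : ProbabilityMeasure X) :
    ∃ f ∈ lipBall x₀ 1,
      W1 μ ξ = ∫ x, f x ∂(μ : Measure X) - ∫ x, f x ∂(ξ : Measure X) := by
  obtain ⟨f, hf, hmax⟩ := exists_mem_lipBall_forall_integral_sub_le x₀ μ ξ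
  refine ⟨f, hf, le_antisymm ?_ (by simpa using integral_sub_le_mul_W1 μ ξ hf.2)⟩
  obtain ⟨π, hπ, hdual⟩ := exists_isCoupling_integral_eq_sInf_dominatingPrices μ ξ
    ⟨fun p => -dist p.1 p.2, by fun_prop⟩
  refine hπ.W1_le.trans ?_
  rw [← neg_le_neg_iff, ← integral_neg]
  refine le_trans (le_csInf (dominatingPrices_nonempty μ ξ _) ?_) hdual.ge
  rintro _ ⟨g, h, hle, rfl⟩
  have : Nonempty X := ⟨x₀⟩
  obtain ⟨u, hu, hhu, hug⟩ := exists_lipschitzWith_one_between hle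
  have hint := integrable_of_continuous hu.continuous
  have hgu : ∫ x, u x ∂(μ : Measure X) ≤ ∫ x, g x ∂(μ : Measure X) :=
    integral_mono (hint _) (integrable_of_continuous g.continuous _) hug
  have hhu' : ∫ x, -h x ∂(ξ : Measure X) ≤ ∫ x, u x ∂(ξ : Measure X) :=
    integral_mono (integrable_of_continuous h.continuous _).neg (hint _) hhu
  have hopt := hmax (-u) hu.neg
  simp only [Pi.neg_apply, integral_neg] at hopt hhu'
  linarith

theorem W1_mix_le (a b : ℝ≥0) (hab : a + b = 1) (μ ξ₁ ξ₂ : ProbabilityMeasure X) :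
    W1 μ (mix a b hab ξ₁ ξ₂) ≤ a * W1 μ ξ₁ + b * W1 μ ξ₂ := by
  obtain ⟨x₀⟩ := μ.nonempty
  obtain ⟨f, hf, heq⟩ := exists_mem_lipBall_W1_eq x₀ μ (mix a b hab ξ₁ ξ₂)
  have h₁ := integral_sub_le_mul_W1 μ ξ₁ hf.2
  have h₂ := integral_sub_le_mul_W1 μ ξ₂ hf.2
  have hsum : (a : ℝ) + b = 1 := mod_cast hab
  calc W1 μ (mix a b hab ξ₁ ξ₂)
      = (a + b) * ∫ x, f x ∂(μ : Measure X) -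
          (a * ∫ x, f x ∂(ξ₁ : Measure X) + b * ∫ x, f x ∂(ξ₂ : Measure X)) := by
        rw [heq, integral_mix a b hab (f.integrable _) (f.integrable _), hsum, one_mul]
    _ = a * (∫ x, f x ∂(μ : Measure X) - ∫ x, f x ∂(ξ₁ : Measure X)) +
          b * (∫ x, f x ∂(μ : Measure X) - ∫ x, f x ∂(ξ₂ : Measure X)) := by ring
    _ ≤ a * W1 μ ξ₁ + b * W1 μ ξ₂ := by
        rw [NNReal.coe_one, one_mul] at h₁ h₂
        gcongr

end KantorovichRubinstein

section Minorant

theorem exists_forall_affine_le_of_convexOn {S : Set ℝ} {f : ℝ → ℝ} (hf : ConvexOn ℝ S f) :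
    ∃ a b : ℝ, ∀ x ∈ S, a * x + b ≤ f x := by
  rcases S.subsingleton_or_nontrivial with hS | hS
  · rcases hS.eq_empty_or_singleton with rfl | ⟨p, rfl⟩
    · exact ⟨0, 0, by simp⟩
    · exact ⟨0, f p, by simp⟩
  obtain ⟨p, hp, q, hq, hpq⟩ := hS.exists_lt
  obtain ⟨m, hm⟩ : (interior S).Nonempty :=
    (Set.nonempty_Ioo.2 hpq).mono (interior_maximal
      (Set.Ioo_subset_Icc_self.trans (hf.1.ordConnected.out hp hq)) isOpen_Ioo)
  set s : ℝ := derivWithin f (Set.Ioi m) m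
  refine ⟨s, f m - s * m, fun x hx => ?_⟩
  rcases lt_trichotomy x m with hxm | rfl | hmx
  · have hslope : slope f x m ≤ s := (hf.slope_le_leftDeriv_of_mem_interior hx hm hxm).trans
      (hf.leftDeriv_le_rightDeriv_of_mem_interior hm)
    rw [slope_def_field, div_le_iff₀ (sub_pos.2 hxm)] at hslope
    linarith
  · linarith
  · have hslope : s ≤ slope f m x := hf.rightDeriv_le_slope_of_mem_interior hm hx hmx
    rw [slope_def_field, le_div_iff₀ (sub_pos.2 hmx)] at hslope
    linarith

theorem coe_mul_add (c : ℝ≥0) (x y : EReal) :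
    ((c : ℝ) : EReal) * (x + y) = (c : ℝ) * x + (c : ℝ) * y :=
  EReal.left_distrib_of_nonneg_of_ne_top (EReal.coe_nonneg.2 c.coe_nonneg) (EReal.coe_ne_top _) x y

variable {φ : ℝ → EReal}

theorem IsConvex.ordConnected_preimage_Iic (hconv : IsConvex φ) (r : EReal) :
    (φ ⁻¹' Set.Iic r).OrdConnected := by
  refine Convex.ordConnected fun x hx y hy s t hs ht hst => ?_
  obtain rfl : t = 1 - s := by linarith
  calc φ (s * x + (1 - s) * y)
    _ ≤ s * φ x + (1 - s : ℝ) * φ y := hconv x y s hs (by linarith)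
    _ ≤ s * r + (1 - s : ℝ) * r := add_le_add
        (mul_le_mul_of_nonneg_left hx (EReal.coe_nonneg.2 hs))
        (mul_le_mul_of_nonneg_left hy (EReal.coe_nonneg.2 ht))
    _ = r := by
        rw [← EReal.right_distrib_of_nonneg (EReal.coe_nonneg.2 hs) (EReal.coe_nonneg.2 ht),
          ← EReal.coe_add, add_sub_cancel, EReal.coe_one, one_mul]

theorem IsConvex.measurable (hconv : IsConvex φ) : Measurable φ :=
  measurable_of_Iic fun r => (hconv.ordConnected_preimage_Iic r).measurableSet

theorem IsConvex.convexOn_toReal (hconv : IsConvex φ) (hbot : ∀ x, φ x ≠ ⊥) :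
    ConvexOn ℝ (effDom φ) fun x => (φ x).toReal := by
  have key : ∀ x ∈ effDom φ, ∀ y ∈ effDom φ, ∀ s t : ℝ, 0 ≤ s → 0 ≤ t → s + t = 1 →
      φ (s * x + t * y) ≤ ((s * (φ x).toReal + t * (φ y).toReal : ℝ) : EReal) := by
    intro x hx y hy s t hs ht hst
    obtain rfl : t = 1 - s := by linarith
    simpa only [EReal.coe_add, EReal.coe_mul, EReal.coe_toReal hx.ne (hbot x),
      EReal.coe_toReal hy.ne (hbot y)] using hconv x y s hs (by linarith)
  refine ⟨fun x hx y hy s t hs ht hst =>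
    (key x hx y hy s t hs ht hst).trans_lt (EReal.coe_lt_top _),
    fun x hx y hy s t hs ht hst => ?_⟩
  exact EReal.toReal_le_toReal (key x hx y hy s t hs ht hst) (hbot _) (EReal.coe_ne_top _)

theorem IsConvex.exists_forall_affine_le (hconv : IsConvex φ) (hbot : ∀ x, φ x ≠ ⊥) :
    ∃ a b : ℝ, ∀ x, ((a * x + b : ℝ) : EReal) ≤ φ x := by
  obtain ⟨a, b, hab⟩ := exists_forall_affine_le_of_convexOn (hconv.convexOn_toReal hbot)
  refine ⟨a, b, fun x => ?_⟩
  by_cases hx : φ x = ⊤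
  · exact hx ▸ le_top
  · rw [← EReal.coe_toReal hx (hbot x)]
    exact EReal.coe_le_coe_iff.2 (hab x (lt_top_iff_ne_top.2 hx))

theorem le_slopeAtTop {a b : ℝ} (hab : ∀ x, ((a * x + b : ℝ) : EReal) ≤ φ x) :
    (a : EReal) ≤ slopeAtTop φ := by
  have hlim : Tendsto (fun x : ℝ => a + b * x⁻¹) atTop (𝓝 a) := by
    simpa using (tendsto_inv_atTop_zero.const_mul b).const_add a
  rw [← ((continuous_coe_real_ereal.tendsto a).comp hlim).limsup_eq]
  refine limsup_le_limsup ?_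
  filter_upwards [eventually_gt_atTop 0] with x hx
  rw [Function.comp_apply, show a + b * x⁻¹ = (a * x + b) / x by field_simp, EReal.coe_div]
  exact EReal.div_le_div_right_of_nonneg (EReal.coe_nonneg.2 hx.le) (hab x)

/-- The excess of `φ` over the affine function `x ↦ a * x + b`, meant for an affine minorant of `φ`
so that no truncation occurs. -/
def excess (φ : ℝ → EReal) (a b x : ℝ) : ℝ≥0∞ := (φ x - ((a * x + b : ℝ) : EReal)).toENNReal

theorem coe_add_excess {a b x : ℝ} (h : ((a * x + b : ℝ) : EReal) ≤ φ x) :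
    ((a * x + b : ℝ) : EReal) + excess φ a b x = φ x := by
  rw [excess, EReal.coe_toENNReal
    ((EReal.sub_nonneg (.inr (EReal.coe_ne_top _)) (.inr (EReal.coe_ne_bot _))).2 h), add_comm,
    EReal.sub_add_cancel]

theorem IsConvex.measurable_excess (hconv : IsConvex φ) (a b : ℝ) : Measurable (excess φ a b) :=
  (hconv.measurable.sub (by fun_prop)).ereal_toENNReal

theorem IsConvex.excess_mix_le (hconv : IsConvex φ) {a b : ℝ}
    (hab : ∀ x, ((a * x + b : ℝ) : EReal) ≤ φ x) {s t : ℝ≥0} (hst : s + t = 1) (x y : ℝ) :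
    excess φ a b (s * x + t * y) ≤ s * excess φ a b x + t * excess φ a b y := by
  have ht : (t : ℝ) = 1 - s := by
    rw [← NNReal.coe_one, ← hst, NNReal.coe_add, add_sub_cancel_left]
  have hs1 : (s : ℝ) ≤ 1 := by linarith [t.coe_nonneg]
  have hφ : φ (s * x + t * y) ≤ ((s * excess φ a b x + t * excess φ a b y : ℝ≥0∞) : EReal) +
      ((a * (s * x + t * y) + b : ℝ) : EReal) := by
    have h := hconv x y s s.coe_nonneg hs1
    rw [← ht, ← coe_add_excess (hab x), ← coe_add_excess (hab y),
      coe_mul_add, coe_mul_add, add_add_add_comm,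
      add_comm ((s : ℝ) * _ + _ : EReal)] at h
    refine h.trans_eq ?_
    rw [EReal.coe_ennreal_add, EReal.coe_ennreal_mul, EReal.coe_ennreal_mul]
    congr 1
    norm_cast
    rw [ht]
    ring_nf
  rw [excess, ← EReal.toENNReal_coe (x := _ + _)]
  exact EReal.toENNReal_le_toENNReal
    ((EReal.sub_le_iff_le_add (.inl (EReal.coe_ne_bot _)) (.inl (EReal.coe_ne_top _))).2 hφ)

end Minorant

section Divergence

theorem toENNReal_add_ofReal_neg (h : ℝ) (u : ℝ≥0∞) :
    ((h : EReal) + u).toENNReal + ENNReal.ofReal (-h) =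
      (-((h : EReal) + u)).toENNReal + (ENNReal.ofReal h + u) := by
  induction u using ENNReal.recTopCoe with
  | top => simp
  | coe u =>
    rw [show ((u : ℝ≥0∞) : EReal) = ((u : ℝ) : EReal) from rfl, ← EReal.coe_add, ← EReal.coe_neg,
      EReal.real_coe_toENNReal, EReal.real_coe_toENNReal]
    simp only [ENNReal.ofReal]
    norm_cast
    rw [← NNReal.coe_inj]
    push_cast [Real.coe_toNNReal']
    linarith [max_zero_sub_eq_self h, max_zero_sub_eq_self (h + u)]

theorem coe_ennreal_sub_eq_of_add_eq {p n hp hn u : ℝ≥0∞} (hn_top : n ≠ ⊤) (hhp : hp ≠ ⊤)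
    (hhn : hn ≠ ⊤) (h : p + hn = n + (hp + u)) :
    (p : EReal) - n = ((hp.toReal - hn.toReal : ℝ) : EReal) + u := by
  lift n to ℝ≥0 using hn_top
  lift hp to ℝ≥0 using hhp
  lift hn to ℝ≥0 using hhn
  rcases eq_or_ne u ⊤ with rfl | hu
  · obtain rfl : p = ⊤ := by simpa using h
    rfl
  lift u to ℝ≥0 using hu
  have hp_top : p ≠ ⊤ := ne_top_of_le_ne_top (by norm_cast; exact ENNReal.coe_ne_top)
    (le_self_add.trans h.le)
  lift p to ℝ≥0 using hp_top
  have hreal : (p : ℝ) + hn = n + (hp + u) := by exact_mod_cast h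
  change ((p : ℝ) : EReal) - ((n : ℝ) : EReal) = ((hp - hn : ℝ) : EReal) + ((u : ℝ) : EReal)
  norm_cast
  linarith

variable {X : Type*} [MeasurableSpace X] {φ : ℝ → EReal}

theorem integralEReal_congr_ae {ν : Measure X} {g₁ g₂ : X → EReal} (h : g₁ =ᵐ[ν] g₂) :
    integralEReal g₁ ν = integralEReal g₂ ν := by
  have hpos := lintegral_congr_ae (h.fun_comp EReal.toENNReal)
  have hneg := lintegral_congr_ae (h.fun_comp fun c => (-c).toENNReal)
  exact congr_arg₂ (fun p n : ℝ≥0∞ => (p : EReal) - n) hpos hneg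

theorem integralEReal_const (ν : Measure X) [IsProbabilityMeasure ν] (c : EReal) :
    integralEReal (fun _ => c) ν = c := by
  rw [integralEReal, lintegral_const, lintegral_const, measure_univ, mul_one, mul_one]
  rcases le_total 0 c with hc | hc
  · rw [EReal.coe_toENNReal hc, EReal.toENNReal_of_nonpos (EReal.neg_le_zero.2 hc),
      EReal.coe_ennreal_zero, sub_zero]
  · rw [EReal.toENNReal_of_nonpos hc, EReal.coe_toENNReal (EReal.neg_nonneg.2 hc),
      EReal.coe_ennreal_zero, zero_sub, neg_neg]

theorem integralEReal_coe_add_coe {ν : Measure X} {h : X → ℝ} (hh : Integrable h ν)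
    (hhm : Measurable h) {u : X → ℝ≥0∞} (hu : Measurable u) :
    integralEReal (fun x => (h x : EReal) + u x) ν =
      ((∫ x, h x ∂ν : ℝ) : EReal) + ((∫⁻ x, u x ∂ν : ℝ≥0∞) : EReal) := by
  have hg : Measurable fun x => (h x : EReal) + u x :=
    hhm.coe_real_ereal.add hu.coe_ereal_ennreal
  have hgm : Measurable fun x => (-((h x : EReal) + u x)).toENNReal := hg.neg.ereal_toENNReal
  have hnegPart : ∀ x, (-((h x : EReal) + u x)).toENNReal ≤ ENNReal.ofReal (-h x) := fun x => by
    rw [← EReal.real_coe_toENNReal, EReal.coe_neg]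
    exact EReal.toENNReal_le_toENNReal (EReal.neg_le_neg_iff.2
      (le_add_of_nonneg_right (EReal.coe_ennreal_nonneg _)))
  have hadd := lintegral_congr (μ := ν) fun x => toENNReal_add_ofReal_neg (h x) (u x)
  rw [lintegral_add_left hg.ereal_toENNReal, lintegral_add_left hgm,
    lintegral_add_right _ hu] at hadd
  rw [integralEReal, integral_eq_lintegral_pos_part_sub_lintegral_neg_part hh]
  exact coe_ennreal_sub_eq_of_add_eq
    (ne_top_of_le_ne_top hh.neg.lintegral_lt_top.ne (lintegral_mono hnegPart))
    hh.lintegral_lt_top.ne hh.neg.lintegral_lt_top.ne hadd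

theorem coe_neg_mul_add_mul {q : EReal} {a : ℝ} (haq : (a : EReal) ≤ q) (m : ℝ≥0) :
    ((-(a * m) : ℝ) : EReal) + q * ((m : ℝ≥0∞) : EReal) =
      (((q - a).toENNReal * m : ℝ≥0∞) : EReal) := by
  rw [EReal.coe_ennreal_mul, EReal.coe_toENNReal
    ((EReal.sub_nonneg (.inr (EReal.coe_ne_top _)) (.inr (EReal.coe_ne_bot _))).2 haq),
    show ((m : ℝ≥0∞) : EReal) = ((m : ℝ) : EReal) from rfl,
    EReal.sub_mul_of_nonneg_of_ne_top (EReal.coe_nonneg.2 m.coe_nonneg) (EReal.coe_ne_top _),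
    EReal.coe_neg, EReal.coe_mul, sub_eq_add_neg, add_comm]

theorem IsConvex.measurable_excess_rnDeriv (hconv : IsConvex φ) (a b : ℝ) (ξ ν : Measure X) :
    Measurable fun x => excess φ a b (ξ.rnDeriv ν x).toReal :=
  (hconv.measurable_excess a b).comp (Measure.measurable_rnDeriv ξ ν).ennreal_toReal

/-- The divergence generated by the excess of `φ` over `x ↦ a * x + b`. -/
def excessDivergence (φ : ℝ → EReal) (a b : ℝ) (ξ ν : ProbabilityMeasure X) : ℝ≥0∞ :=
  ∫⁻ x, excess φ a b ((ξ : Measure X).rnDeriv ν x).toReal ∂(ν : Measure X) +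
    (slopeAtTop φ - (a : EReal)).toENNReal * (ξ : Measure X).singularPart ν Set.univ

theorem IsConvex.divergence_eq_add_excessDivergence (hconv : IsConvex φ) {a b : ℝ}
    (hab : ∀ x, ((a * x + b : ℝ) : EReal) ≤ φ x) (ξ ν : ProbabilityMeasure X) :
    divergence φ ξ ν = ((a + b : ℝ) : EReal) + excessDivergence φ a b ξ ν := by
  have hint : Integrable (fun x => a * ((ξ : Measure X).rnDeriv ν x).toReal) (ν : Measure X) :=
    Measure.integrable_toReal_rnDeriv.const_mul a
  have habs : integralEReal (fun x => φ ((ξ : Measure X).rnDeriv ν x).toReal) (ν : Measure X) =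
      ((a * (1 - ((ξ : Measure X).singularPart ν).real Set.univ) + b : ℝ) : EReal) +
        ((∫⁻ x, excess φ a b ((ξ : Measure X).rnDeriv ν x).toReal ∂(ν : Measure X) : ℝ≥0∞) :
          EReal) := by
    simp only [← coe_add_excess (hab _)]
    rw [integralEReal_coe_add_coe (h := fun x => a * ((ξ : Measure X).rnDeriv ν x).toReal + b)
      (hint.add (integrable_const b)) (by fun_prop) (hconv.measurable_excess_rnDeriv a b _ _),
      integral_add hint (integrable_const b), integral_const_mul, Measure.integral_toReal_rnDeriv',
      probReal_univ (μ := (ξ : Measure X)), integral_const,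
      probReal_univ (μ := (ν : Measure X)), one_smul]
  have hslope := coe_neg_mul_add_mul (le_slopeAtTop hab)
    ((ξ : Measure X).singularPart ν Set.univ).toNNReal
  rw [ENNReal.coe_toNNReal (measure_ne_top _ _)] at hslope
  rw [divergence, habs, excessDivergence, EReal.coe_ennreal_add, ← hslope, measureReal_def,
    ENNReal.toReal]
  generalize (((ξ : Measure X).singularPart ν Set.univ).toNNReal : ℝ) = m
  rw [show a * (1 - m) + b = (a + b) + -(a * m) by ring, EReal.coe_add]
  abel

theorem divergence_self (φ : ℝ → EReal) (ν : ProbabilityMeasure X) : divergence φ ν ν = φ 1 := by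
  have hφ : (fun x => φ ((ν : Measure X).rnDeriv ν x).toReal) =ᵐ[(ν : Measure X)] fun _ => φ 1 := by
    filter_upwards [Measure.rnDeriv_self (ν : Measure X)] with x hx
    rw [hx, ENNReal.toReal_one]
  rw [divergence, integralEReal_congr_ae hφ, integralEReal_const, Measure.singularPart_self,
    Measure.coe_zero, Pi.zero_apply, EReal.coe_ennreal_zero, mul_zero, add_zero]

theorem IsConvex.lintegral_excess_mix_le (hconv : IsConvex φ) {a b : ℝ}
    (hab : ∀ x, ((a * x + b : ℝ) : EReal) ≤ φ x) (s t : ℝ≥0) (hst : s + t = 1)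
    (ξ₁ ξ₂ ν : ProbabilityMeasure X) :
    ∫⁻ x, excess φ a b ((mix s t hst ξ₁ ξ₂ : Measure X).rnDeriv ν x).toReal ∂(ν : Measure X) ≤
      s * ∫⁻ x, excess φ a b ((ξ₁ : Measure X).rnDeriv ν x).toReal ∂(ν : Measure X) +
        t * ∫⁻ x, excess φ a b ((ξ₂ : Measure X).rnDeriv ν x).toReal ∂(ν : Measure X) := by
  have hmeas := fun ξ : ProbabilityMeasure X =>
    hconv.measurable_excess_rnDeriv a b (ξ : Measure X) ν
  rw [← lintegral_const_mul _ (hmeas ξ₁), ← lintegral_const_mul _ (hmeas ξ₂),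
    ← lintegral_add_left ((hmeas ξ₁).const_mul _), coe_mix]
  refine lintegral_mono_ae ?_
  filter_upwards [Measure.rnDeriv_add (s • (ξ₁ : Measure X)) (t • (ξ₂ : Measure X)) (ν : Measure X),
    Measure.rnDeriv_smul_left (ξ₁ : Measure X) (ν : Measure X) s,
    Measure.rnDeriv_smul_left (ξ₂ : Measure X) (ν : Measure X) t,
    Measure.rnDeriv_lt_top (ξ₁ : Measure X) (ν : Measure X),
    Measure.rnDeriv_lt_top (ξ₂ : Measure X) (ν : Measure X)] with x hadd h₁ h₂ h₁_top h₂_top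
  rw [hadd, Pi.add_apply, h₁, h₂, Pi.smul_apply, Pi.smul_apply, ENNReal.smul_def,
    ENNReal.smul_def, smul_eq_mul, smul_eq_mul,
    ENNReal.toReal_add (ENNReal.mul_ne_top ENNReal.coe_ne_top h₁_top.ne)
      (ENNReal.mul_ne_top ENNReal.coe_ne_top h₂_top.ne), ENNReal.toReal_mul, ENNReal.toReal_mul,
    ENNReal.coe_toReal, ENNReal.coe_toReal]
  exact hconv.excess_mix_le hab hst _ _

theorem IsConvex.excessDivergence_mix_le (hconv : IsConvex φ) {a b : ℝ}
    (hab : ∀ x, ((a * x + b : ℝ) : EReal) ≤ φ x) (s t : ℝ≥0) (hst : s + t = 1)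
    (ξ₁ ξ₂ ν : ProbabilityMeasure X) :
    excessDivergence φ a b (mix s t hst ξ₁ ξ₂) ν ≤
      s * excessDivergence φ a b ξ₁ ν + t * excessDivergence φ a b ξ₂ ν := by
  have hsing : (mix s t hst ξ₁ ξ₂ : Measure X).singularPart ν Set.univ =
      s * (ξ₁ : Measure X).singularPart ν Set.univ +
        t * (ξ₂ : Measure X).singularPart ν Set.univ := by
    rw [coe_mix, Measure.singularPart_add, Measure.singularPart_smul, Measure.singularPart_smul]
    rfl
  unfold excessDivergence
  rw [hsing]
  refine (add_le_add_left (hconv.lintegral_excess_mix_le hab s t hst ξ₁ ξ₂ ν) _).trans_eq ?_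
  ring

/-- Convexity of an extended-real-valued function along mixtures of probability measures. -/
def IsMixConvex (D : ProbabilityMeasure X → EReal) : Prop :=
  ∀ (a b : ℝ≥0) (hab : a + b = 1) (ξ₁ ξ₂ : ProbabilityMeasure X),
    D (mix a b hab ξ₁ ξ₂) ≤ (a : ℝ) * D ξ₁ + (b : ℝ) * D ξ₂

theorem IsMixConvex.mix_le_coe {D : ProbabilityMeasure X → EReal} (hD : IsMixConvex D)
    {a b : ℝ≥0} (hab : a + b = 1) {ξ₁ ξ₂ : ProbabilityMeasure X} {r₁ r₂ : ℝ} (h₁ : D ξ₁ ≤ r₁)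
    (h₂ : D ξ₂ ≤ r₂) : D (mix a b hab ξ₁ ξ₂) ≤ ((a * r₁ + b * r₂ : ℝ) : EReal) := by
  rw [EReal.coe_add, EReal.coe_mul, EReal.coe_mul]
  refine (hD a b hab ξ₁ ξ₂).trans ?_
  gcongr

theorem IsConvex.isMixConvex_divergence (hconv : IsConvex φ) (hbot : ∀ x, φ x ≠ ⊥)
    (ν : ProbabilityMeasure X) : IsMixConvex fun ξ => divergence φ ξ ν := by
  obtain ⟨a, b, hab⟩ := hconv.exists_forall_affine_le hbot
  intro s t hst ξ₁ ξ₂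
  have hst' : ((a + b : ℝ) : EReal) = (s : ℝ) * ((a + b : ℝ) : EReal) +
      (t : ℝ) * ((a + b : ℝ) : EReal) := by
    rw [← EReal.coe_mul, ← EReal.coe_mul, ← EReal.coe_add, ← add_mul, ← NNReal.coe_add, hst,
      NNReal.coe_one, one_mul]
  have hexc : (excessDivergence φ a b (mix s t hst ξ₁ ξ₂) ν : EReal) ≤
      (s : ℝ) * (excessDivergence φ a b ξ₁ ν : EReal) +
        (t : ℝ) * (excessDivergence φ a b ξ₂ ν : EReal) :=
    EReal.coe_ennreal_le_coe_ennreal_iff.2 (hconv.excessDivergence_mix_le hab s t hst ξ₁ ξ₂ ν)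
      |>.trans_eq (by rw [EReal.coe_ennreal_add, EReal.coe_ennreal_mul, EReal.coe_ennreal_mul]; rfl)
  simp only [hconv.divergence_eq_add_excessDivergence hab]
  rw [coe_mul_add, coe_mul_add, add_add_add_comm, ← hst']
  gcongr

theorem IsConvex.divergence_ne_bot (hconv : IsConvex φ) (hbot : ∀ x, φ x ≠ ⊥)
    (ξ ν : ProbabilityMeasure X) : divergence φ ξ ν ≠ ⊥ := by
  obtain ⟨a, b, hab⟩ := hconv.exists_forall_affine_le hbot
  rw [hconv.divergence_eq_add_excessDivergence hab]
  exact EReal.add_ne_bot_iff.2 ⟨EReal.coe_ne_bot _, EReal.coe_ennreal_ne_bot _⟩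

end Divergence

section Penalty

/-- The convex conjugate of `w ↦ lam * w ^ α` on the nonnegative reals, which is the last term of
the dual objective for `1 < α`. -/
def penalty (lam α l : ℝ) : ℝ :=
  (α - 1) * α ^ (α / (1 - α)) * lam ^ (1 / (1 - α)) * l ^ (α / (α - 1))

variable {lam α w : ℝ}

theorem penalty_eq_mul_rpow (hlam : 0 < lam) (hα : 1 < α) (l : ℝ) :
    penalty lam α l = (α - 1) / α * (α * lam) ^ (1 / (1 - α)) * l ^ (α / (α - 1)) := by
  have hα₀ : 0 < α := by linarith
  have hα₁ : 1 - α ≠ 0 := by linarith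
  have hexp : α / (1 - α) = 1 / (1 - α) - 1 := by
    field_simp
    ring
  rw [penalty, hexp, Real.rpow_sub_one hα₀.ne', Real.mul_rpow hα₀.le hlam.le]
  ring

theorem mul_le_add_penalty {l : ℝ} (hlam : 0 < lam) (hα : 1 < α) (hl : 0 ≤ l) (hw : 0 ≤ w) :
    l * w ≤ lam * w ^ α + penalty lam α l := by
  have hα₀ : 0 < α := by linarith
  have hα₁ : 1 - α ≠ 0 := by linarith
  have hB : 0 < α * lam := by positivity
  have hexp : -(1 / α) * (α / (α - 1)) = 1 / (1 - α) := by
    rw [← neg_sub 1 α]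
    field_simp
  have hpow : ((α * lam) ^ (1 / α) * w) ^ α / α = lam * w ^ α := by
    rw [Real.mul_rpow (by positivity) hw, ← Real.rpow_mul hB.le, one_div_mul_cancel hα₀.ne',
      Real.rpow_one]
    field_simp
  have hpen : ((α * lam) ^ (-(1 / α)) * l) ^ (α / (α - 1)) / (α / (α - 1)) = penalty lam α l := by
    rw [Real.mul_rpow (by positivity) hl, ← Real.rpow_mul hB.le, hexp,
      penalty_eq_mul_rpow hlam hα]
    field_simp
  calc l * w = (α * lam) ^ (1 / α) * w * ((α * lam) ^ (-(1 / α)) * l) := by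
        rw [Real.rpow_neg hB.le]
        field_simp
    _ ≤ ((α * lam) ^ (1 / α) * w) ^ α / α +
          ((α * lam) ^ (-(1 / α)) * l) ^ (α / (α - 1)) / (α / (α - 1)) :=
        Real.young_inequality_of_nonneg (by positivity) (by positivity)
          (Real.HolderConjugate.conjExponent hα)
    _ = lam * w ^ α + penalty lam α l := by rw [hpow, hpen]

theorem penalty_mul_rpow_sub_one (hlam : 0 < lam) (hα : 1 < α) (hw : 0 ≤ w) :
    penalty lam α (α * lam * w ^ (α - 1)) = (α - 1) * lam * w ^ α := by
  have hα₀ : 0 < α := by linarith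
  have hα₁ : 1 - α ≠ 0 := by linarith
  have hB : 0 < α * lam := mul_pos hα₀ hlam
  have hexp : 1 / (1 - α) + α / (α - 1) = 1 := by
    rw [← neg_sub 1 α]
    field_simp
    ring
  calc penalty lam α (α * lam * w ^ (α - 1))
      = (α - 1) / α * ((α * lam) ^ (1 / (1 - α)) * (α * lam) ^ (α / (α - 1))) * w ^ α := by
        rw [penalty_eq_mul_rpow hlam hα, Real.mul_rpow hB.le (by positivity), ← Real.rpow_mul hw,
          mul_div_cancel₀ _ (sub_pos.2 hα).ne']
        ring
    _ = (α - 1) * lam * w ^ α := by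
        rw [← Real.rpow_add hB, hexp, Real.rpow_one]
        field_simp

theorem mul_rpow_sub_one_mul_self (lam : ℝ) (hα : α ≠ 0) (hw : 0 ≤ w) :
    α * lam * w ^ (α - 1) * w = α * (lam * w ^ α) := by
  rw [mul_assoc, ← Real.rpow_add_one' hw (by simpa using hα), sub_add_cancel, mul_assoc]

theorem add_mul_nonneg_of_forall_segment {δ a : ℝ} (hα : 1 ≤ α)
    (h : ∀ t ∈ Set.Ioo (0 : ℝ) 1, 0 ≤ t * a + lam * ((w + t * δ) ^ α - w ^ α)) :
    0 ≤ a + α * lam * w ^ (α - 1) * δ := by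
  have hseg : HasDerivAt (fun t : ℝ => w + t * δ) δ 0 := by
    simpa using ((hasDerivAt_id (0 : ℝ)).mul_const δ).const_add w
  have hderiv : HasDerivAt (fun t : ℝ => t * a + lam * ((w + t * δ) ^ α - w ^ α))
      (a + α * lam * w ^ (α - 1) * δ) 0 := by
    refine (((hasDerivAt_id (0 : ℝ)).mul_const a).add
      (((hseg.rpow_const (Or.inr hα)).sub_const (w ^ α)).const_mul lam)).congr_deriv ?_
    rw [zero_mul, add_zero]
    ring
  refine ge_of_tendsto hderiv.tendsto_slope_zero_right ?_
  filter_upwards [Ioo_mem_nhdsGT (zero_lt_one' ℝ)] with t ht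
  simp only [zero_add, zero_mul, add_zero, sub_self, mul_zero, sub_zero, smul_eq_mul]
  exact mul_nonneg (inv_nonneg.2 ht.1.le) (h t ht)

end Penalty

section Optimality

open scoped BoundedContinuousFunction

variable {X : Type*} [MetricSpace X] [CompactSpace X] [MeasurableSpace X] [BorelSpace X]
  {D : ProbabilityMeasure X → EReal} {μ ξ : ProbabilityMeasure X}

theorem IsMixConvex.add_mul_W1_le_of_isMin (hD : IsMixConvex D) {lam α d : ℝ} (hlam : 0 ≤ lam)
    (hα : 1 ≤ α) (hd : D ξ ≤ d)
    (hmin : ∀ η (r : ℝ), D η ≤ r → d + lam * W1 μ ξ ^ α ≤ r + lam * W1 μ η ^ α)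
    {η : ProbabilityMeasure X} {r : ℝ} (hη : D η ≤ r) :
    d + α * lam * W1 μ ξ ^ (α - 1) * W1 μ ξ ≤ r + α * lam * W1 μ ξ ^ (α - 1) * W1 μ η := by
  have hsegment : ∀ t ∈ Set.Ioo (0 : ℝ) 1, 0 ≤ t * (r - d) +
      lam * ((W1 μ ξ + t * (W1 μ η - W1 μ ξ)) ^ α - W1 μ ξ ^ α) := by
    rintro t ⟨h0, h1⟩
    lift t to ℝ≥0 using h0.le
    have hst : t + (1 - t) = 1 := add_tsub_cancel_of_le (by exact_mod_cast h1.le)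
    have hcoe : ((1 - t : ℝ≥0) : ℝ) = 1 - t := NNReal.coe_sub (by exact_mod_cast h1.le)
    have hW := W1_mix_le t (1 - t) hst μ η ξ
    have hle := hmin _ _ (hD.mix_le_coe hst hη hd)
    rw [hcoe] at hW hle
    have hpow : W1 μ (mix t (1 - t) hst η ξ) ^ α ≤ (W1 μ ξ + t * (W1 μ η - W1 μ ξ)) ^ α :=
      Real.rpow_le_rpow (W1_nonneg _ _) (by linarith) (by linarith)
    linarith [mul_le_mul_of_nonneg_left hpow hlam]
  linarith [add_mul_nonneg_of_forall_segment hα hsegment]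

theorem IsMixConvex.exists_mem_lipBall_forall_le (hD : IsMixConvex D) (x₀ : X) {c : ℝ≥0} {m : ℝ}
    (hmin : ∀ η (r : ℝ), D η ≤ r → m ≤ r + c * W1 μ η) :
    ∃ f ∈ lipBall x₀ c, ∀ η (r : ℝ), D η ≤ r →
      m ≤ r + (∫ x, f x ∂(μ : Measure X) - ∫ x, f x ∂(η : Measure X)) := by
  let A : Set (StrongDual ℝ (X →ᵇ ℝ) × ℝ) :=
    {p | ∃ η, ∃ r : ℝ, D η ≤ r ∧ p = (integralCLM η - integralCLM μ, r - m)}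
  have hA : Convex ℝ A := by
    rintro _ ⟨η₁, r₁, h₁, rfl⟩ _ ⟨η₂, r₂, h₂, rfl⟩ a b ha hb hab
    lift a to ℝ≥0 using ha
    lift b to ℝ≥0 using hb
    have hab' : a + b = 1 := by exact_mod_cast hab
    refine ⟨mix a b hab' η₁ η₂, a * r₁ + b * r₂, hD.mix_le_coe hab' h₁ h₂, Prod.ext ?_ ?_⟩
    · refine ContinuousLinearMap.ext fun f => ?_
      simp only [integralCLM_mix, Prod.fst_add, Prod.smul_fst, add_apply, sub_apply,
        smul_apply, smul_eq_mul]
      linear_combination (-integralCLM μ f) * hab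
    · simp only [Prod.snd_add, Prod.smul_snd, smul_eq_mul]
      linear_combination (-m) * hab
  have hsolvable : ∀ p ∈ A, ∃ f ∈ lipBall x₀ c, p.1 f ≤ p.2 := by
    rintro _ ⟨η, r, hr, rfl⟩
    obtain ⟨k, hk, hkW⟩ := exists_mem_lipBall_W1_eq x₀ μ η
    refine ⟨(c : ℝ) • k, by simpa using smul_mem_lipBall hk c, ?_⟩
    have hle := hmin η r hr
    rw [hkW] at hle
    simp only [sub_apply, map_smul, integralCLM_apply, smul_eq_mul]
    linarith
  obtain ⟨f, hf, hfA⟩ := exists_mem_forall_apply_le (isCompact_lipBall x₀ c)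
    (convex_lipBall x₀ c) ⟨0, zero_mem_lipBall x₀ c⟩ hA hsolvable
  refine ⟨f, hf, fun η r hr => ?_⟩
  have hle := hfA _ ⟨η, r, hr, rfl⟩
  simp only [sub_apply, integralCLM_apply] at hle
  linarith

theorem lipNorm_eq_of_integral_sub_eq {f : X → ℝ} {c : ℝ≥0} (hf : LipschitzWith c f)
    (hgap : ∫ x, f x ∂(μ : Measure X) - ∫ x, f x ∂(ξ : Measure X) = c * W1 μ ξ)
    (hW : 0 < W1 μ ξ) : lipNorm f = c := by
  have hle := integral_sub_le_mul_W1 μ ξ (IsLip.lipschitzWith_lipNorm ⟨c, hf⟩)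
  rw [hgap, Real.coe_toNNReal _ (lipNorm_nonneg f)] at hle
  exact (lipNorm_le_of_lipschitzWith hf).antisymm (le_of_mul_le_mul_right hle hW)

theorem exists_isKantorovichPotential_eq_mul {x₀ : X} {f : X →ᵇ ℝ} {c : ℝ≥0}
    (hf : f ∈ lipBall x₀ c)
    (hgap : ∫ x, f x ∂(μ : Measure X) - ∫ x, f x ∂(ξ : Measure X) = c * W1 μ ξ) :
    ∃ k : X → ℝ, IsKantorovichPotential μ ξ k ∧ f = fun x => c * k x := by
  suffices h : ∃ k ∈ lipBall x₀ 1,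
      W1 μ ξ = ∫ x, k x ∂(μ : Measure X) - ∫ x, k x ∂(ξ : Measure X) ∧ f = (c : ℝ) • k by
    obtain ⟨k, hk, hkW, hfk⟩ := h
    exact ⟨k, ⟨⟨1, hk.2⟩, lipNorm_le_of_lipschitzWith hk.2, hkW⟩, congr_arg _ hfk⟩
  rcases eq_or_ne c 0 with rfl | hc
  · obtain ⟨k, hk, hkW⟩ := exists_mem_lipBall_W1_eq x₀ μ ξ
    refine ⟨k, hk, hkW, BoundedContinuousFunction.ext fun x => ?_⟩
    have hfx := hf.2.dist_le_mul x x₀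
    rw [NNReal.coe_zero, zero_mul, hf.1] at hfx
    rw [dist_le_zero.1 hfx, NNReal.coe_zero, zero_smul,
      BoundedContinuousFunction.coe_zero, Pi.zero_apply]
  · have hc' : (c : ℝ) ≠ 0 := NNReal.coe_ne_zero.2 hc
    refine ⟨(c : ℝ)⁻¹ • f, by simpa [hc] using smul_mem_lipBall hf (c : ℝ)⁻¹, ?_,
      (smul_inv_smul₀ hc' f).symm⟩
    simp only [BoundedContinuousFunction.coe_smul, smul_eq_mul, integral_const_mul]
    rw [← mul_sub, hgap, inv_mul_cancel_left₀ hc']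

end Optimality

section Duality

variable {X : Type*} [MeasurableSpace X] {φ : ℝ → EReal} {lam α : ℝ} {μ ν ξ : ProbabilityMeasure X}

theorem coe_sub_coe_sub (a b : ℝ) (x : EReal) :
    (a : EReal) - (b - x) = x + ((a - b : ℝ) : EReal) := by
  induction x with
  | bot => rfl
  | top => rfl
  | coe x =>
    norm_cast
    ring

theorem coe_sub_add_coe_sub (a b : ℝ) (x : EReal) :
    (a : EReal) - x + ((b - a : ℝ) : EReal) = b - x := by
  induction x with
  | bot => rfl
  | top => rfl
  | coe x =>
    norm_cast
    ring

theorem add_coe_sub_coe (x : EReal) (a b : ℝ) :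
    x + (a : EReal) - (b : EReal) = x + ((a - b : ℝ) : EReal) := by
  rw [EReal.coe_sub, sub_eq_add_neg, sub_eq_add_neg, add_assoc]

theorem integral_sub_tightConjugate_le (μ ξ : ProbabilityMeasure X) (f : X → ℝ) :
    ((∫ x, f x ∂(μ : Measure X) : ℝ) : EReal) - tightConjugate φ ν f ≤ divergence φ ξ ν +
      ((∫ x, f x ∂(μ : Measure X) - ∫ x, f x ∂(ξ : Measure X) : ℝ) : EReal) := by
  rw [← coe_sub_coe_sub]
  exact EReal.sub_le_sub le_rfl (le_iSup (fun ξ : ProbabilityMeasure X =>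
    ((∫ x, f x ∂(ξ : Measure X) : ℝ) : EReal) - divergence φ ξ ν) ξ)

variable [MetricSpace X]

theorem IsCsiszarPotential.integral_sub_tightConjugate {f : X → ℝ}
    (hf : IsCsiszarPotential φ ξ ν f) (μ : ProbabilityMeasure X) :
    ((∫ x, f x ∂(μ : Measure X) : ℝ) : EReal) - tightConjugate φ ν f = divergence φ ξ ν +
      ((∫ x, f x ∂(μ : Measure X) - ∫ x, f x ∂(ξ : Measure X) : ℝ) : EReal) := by
  rw [hf.2, coe_sub_add_coe_sub]

theorem isCsiszarPotential_of_forall_le {f : X → ℝ} (hf : IsLip f) {d : ℝ}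
    (hd : divergence φ ξ ν = d) (hbot : ∀ η, divergence φ η ν ≠ ⊥)
    (h : ∀ η (r : ℝ), divergence φ η ν ≤ r →
      ∫ x, f x ∂(η : Measure X) - r ≤ ∫ x, f x ∂(ξ : Measure X) - d) :
    IsCsiszarPotential φ ξ ν f := by
  have hconj : tightConjugate φ ν f = ((∫ x, f x ∂(ξ : Measure X) - d : ℝ) : EReal) := by
    refine le_antisymm (iSup_le fun η => ?_) ?_
    · rcases eq_or_ne (divergence φ η ν) ⊤ with htop | htop
      · rw [htop, EReal.sub_top]
        exact bot_le
      · lift divergence φ η ν to ℝ using ⟨htop, hbot η⟩ with r hr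
        exact_mod_cast h η r hr.ge
    · rw [EReal.coe_sub, ← hd]
      exact le_iSup (fun η : ProbabilityMeasure X =>
        ((∫ x, f x ∂(η : Measure X) : ℝ) : EReal) - divergence φ η ν) ξ
  refine ⟨hf, ?_⟩
  rw [hconj, hd, ← EReal.coe_sub, sub_sub_cancel]

theorem divergence_ne_top_of_primalObjective_le (hone : (1 : ℝ) ∈ effDom φ)
    (hmin : ∀ η, primalObjective φ lam α μ ν ξ ≤ primalObjective φ lam α μ ν η) :
    divergence φ ξ ν ≠ ⊤ := by
  intro htop
  have hle := hmin ν
  rw [primalObjective, htop, EReal.top_add_coe, top_le_iff, primalObjective, divergence_self] at hle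
  exact (EReal.add_lt_top hone.ne (EReal.coe_ne_top _)).ne hle

theorem dualObjective_of_one_lt (hα : 1 < α) (f : X → ℝ) :
    dualObjective φ lam α μ ν f = ((∫ x, f x ∂(μ : Measure X) : ℝ) : EReal) -
      tightConjugate φ ν f - ((penalty lam α (lipNorm f) : ℝ) : EReal) :=
  if_neg hα.ne'

theorem dualObjective_one (f : X → ℝ) :
    dualObjective φ lam 1 μ ν f =
      ((∫ x, f x ∂(μ : Measure X) : ℝ) : EReal) - tightConjugate φ ν f :=
  if_pos rfl

theorem IsCsiszarPotential.dualObjective_eq_primalObjective {f : X → ℝ}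
    (hf : IsCsiszarPotential φ ξ ν f) (hlam : 0 < lam) (hα : 1 ≤ α)
    (hnorm : 1 < α → lipNorm f = α * lam * W1 μ ξ ^ (α - 1))
    (hgap : ∫ x, f x ∂(μ : Measure X) - ∫ x, f x ∂(ξ : Measure X) =
      α * lam * W1 μ ξ ^ (α - 1) * W1 μ ξ) :
    dualObjective φ lam α μ ν f = primalObjective φ lam α μ ν ξ := by
  have hW := W1_nonneg μ ξ
  have hval := hf.integral_sub_tightConjugate μ
  rw [hgap, mul_rpow_sub_one_mul_self lam (by linarith) hW] at hval
  rcases hα.eq_or_lt with rfl | hα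
  · rw [dualObjective_one, hval, one_mul, primalObjective]
  · rw [dualObjective_of_one_lt hα, hval, hnorm hα, penalty_mul_rpow_sub_one hlam hα hW,
      add_coe_sub_coe, primalObjective]
    ring_nf

variable [CompactSpace X] [BorelSpace X]

theorem dualObjective_le_primalObjective (hlam : 0 < lam) (hα : 1 ≤ α) {x₀ : X} {g : X → ℝ}
    (hg : g ∈ dualFeasible lam α x₀) (ξ : ProbabilityMeasure X) :
    dualObjective φ lam α μ ν g ≤ primalObjective φ lam α μ ν ξ := by
  have hW := W1_nonneg μ ξ
  have hgap := integral_sub_le_mul_W1 μ ξ hg.1.1.lipschitzWith_lipNorm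
  rw [Real.coe_toNNReal _ (lipNorm_nonneg g)] at hgap
  have hle := integral_sub_tightConjugate_le (φ := φ) (ν := ν) μ ξ g
  rcases hα.eq_or_lt with rfl | hα
  · rw [dualObjective_one]
    refine hle.trans (add_le_add_right (EReal.coe_le_coe_iff.2 ?_) _)
    rw [Real.rpow_one]
    exact hgap.trans (mul_le_mul_of_nonneg_right (hg.2 rfl) hW)
  · rw [dualObjective_of_one_lt hα]
    refine (EReal.sub_le_sub hle le_rfl).trans ?_
    rw [add_coe_sub_coe]
    refine add_le_add_right (EReal.coe_le_coe_iff.2 ?_) _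
    linarith [mul_le_add_penalty hlam hα (lipNorm_nonneg g) hW]

theorem lipNorm_eq_of_integral_sub_eq_mul_rpow {f : X → ℝ} {c : ℝ≥0} (hf : LipschitzWith c f)
    (hc : (c : ℝ) = α * lam * W1 μ ξ ^ (α - 1))
    (hgap : ∫ x, f x ∂(μ : Measure X) - ∫ x, f x ∂(ξ : Measure X) = c * W1 μ ξ)
    (h : 1 < α ∨ μ ≠ ξ) : lipNorm f = c := by
  rcases (W1_nonneg μ ξ).eq_or_lt with hW | hW
  · have hα : 1 < α := h.resolve_right (not_not.2 (eq_of_W1_eq_zero hW.symm))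
    rw [← hW, Real.zero_rpow (sub_pos.2 hα).ne', mul_zero] at hc
    exact (lipNorm_le_of_lipschitzWith hf).antisymm (hc.trans_le (lipNorm_nonneg f))
  · exact lipNorm_eq_of_integral_sub_eq hf hgap hW

theorem IsConvex.exists_mem_lipBall_isCsiszarPotential (hconv : IsConvex φ)
    (hbot : ∀ x, φ x ≠ ⊥) (x₀ : X) (hlam : 0 ≤ lam) (hα : 1 ≤ α) (hξ : divergence φ ξ ν ≠ ⊤)
    (hmin : ∀ η, primalObjective φ lam α μ ν ξ ≤ primalObjective φ lam α μ ν η) {c : ℝ≥0}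
    (hc : (c : ℝ) = α * lam * W1 μ ξ ^ (α - 1)) :
    ∃ f ∈ lipBall x₀ c, IsCsiszarPotential φ ξ ν f ∧
      ∫ x, f x ∂(μ : Measure X) - ∫ x, f x ∂(ξ : Measure X) = c * W1 μ ξ := by
  have hD := hconv.isMixConvex_divergence hbot ν
  lift divergence φ ξ ν to ℝ using ⟨hξ, hconv.divergence_ne_bot hbot ξ ν⟩ with d hd
  have hmin' : ∀ η (r : ℝ), divergence φ η ν ≤ r →
      d + lam * W1 μ ξ ^ α ≤ r + lam * W1 μ η ^ α := fun η r hr => by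
    have hle := (hmin η).trans (add_le_add_left hr _)
    rw [primalObjective, ← hd] at hle
    exact_mod_cast hle
  obtain ⟨f, hf, hle⟩ := hD.exists_mem_lipBall_forall_le x₀ fun η r hr =>
    hc ▸ hD.add_mul_W1_le_of_isMin hlam hα hd.ge hmin' hr
  have hgap : ∫ x, f x ∂(μ : Measure X) - ∫ x, f x ∂(ξ : Measure X) = c * W1 μ ξ :=
    (integral_sub_le_mul_W1 μ ξ hf.2).antisymm (by linarith [hle ξ d hd.ge])
  refine ⟨f, hf, isCsiszarPotential_of_forall_le ⟨c, hf.2⟩ hd.symm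
    (fun η => hconv.divergence_ne_bot hbot η ν) fun η r hr => ?_, hgap⟩
  linarith [hle η r hr]

end Duality

end

end MoreauYosida

theorem proposition5_general {X : Type*} [MetricSpace X] [CompactSpace X] [MeasurableSpace X]
    [BorelSpace X] (x₀ : X) (φ : ℝ → EReal) (hconv : MoreauYosida.IsConvex φ)
    (hbot : ∀ x, φ x ≠ ⊥) (hone : (1 : ℝ) ∈ MoreauYosida.effDom φ)
    (lam α : ℝ) (hlam : 0 < lam) (hα : 1 ≤ α)
    (μ ν ξ : ProbabilityMeasure X)
    (hξ : MoreauYosida.moreauYosida φ lam α μ ν =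
      MoreauYosida.primalObjective φ lam α μ ν ξ) :
    ∃ f : X → ℝ,
      f ∈ MoreauYosida.dualFeasible lam α x₀ ∧
      IsMaxOn (MoreauYosida.dualObjective φ lam α μ ν)
        (MoreauYosida.dualFeasible lam α x₀) f ∧
      MoreauYosida.dualObjective φ lam α μ ν f = MoreauYosida.moreauYosida φ lam α μ ν ∧
      MoreauYosida.IsCsiszarPotential φ ξ ν f ∧
      (∃ k : X → ℝ, MoreauYosida.IsKantorovichPotential μ ξ k ∧
        f = fun x => α * lam * MoreauYosida.W1 μ ξ ^ (α - 1) * k x) ∧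
      ((1 < α ∨ μ ≠ ξ) →
        MoreauYosida.lipNorm f = α * lam * MoreauYosida.W1 μ ξ ^ (α - 1)) := by
  open MoreauYosida in
  have hmin : ∀ η, primalObjective φ lam α μ ν ξ ≤ primalObjective φ lam α μ ν η :=
    fun η => hξ ▸ iInf_le _ η
  have hfin : divergence φ ξ ν ≠ ⊤ := divergence_ne_top_of_primalObjective_le hone hmin
  have hslope : 0 ≤ α * lam * W1 μ ξ ^ (α - 1) := by
    have := W1_nonneg μ ξ
    positivity
  obtain ⟨c, hc⟩ : ∃ c : ℝ≥0, (c : ℝ) = α * lam * W1 μ ξ ^ (α - 1) := ⟨⟨_, hslope⟩, rfl⟩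
  obtain ⟨f, hf, hcsiszar, hgap⟩ :=
    hconv.exists_mem_lipBall_isCsiszarPotential hbot x₀ hlam.le hα hfin hmin hc
  have hnorm : 1 < α ∨ μ ≠ ξ → lipNorm f = c :=
    lipNorm_eq_of_integral_sub_eq_mul_rpow hf.2 hc hgap
  have hval : dualObjective φ lam α μ ν f = primalObjective φ lam α μ ν ξ :=
    hcsiszar.dualObjective_eq_primalObjective hlam hα (fun h => hc ▸ hnorm (.inl h)) (hc ▸ hgap)
  have hfeas : ⇑f ∈ dualFeasible lam α x₀ := ⟨⟨⟨c, hf.2⟩, hf.1⟩, fun h =>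
    (lipNorm_le_of_lipschitzWith hf.2).trans_eq (by simp [hc, h])⟩
  have hmax : IsMaxOn (dualObjective φ lam α μ ν) (dualFeasible lam α x₀) f := fun _ hg =>
    (dualObjective_le_primalObjective hlam hα hg ξ).trans_eq hval.symm
  exact ⟨f, hfeas, hmax, hval.trans hξ.symm, hcsiszar,
    hc ▸ exists_isKantorovichPotential_eq_mul hf hgap, hc ▸ hnorm⟩

theorem proposition5 {X : Type*} [MetricSpace X] [CompactSpace X] [MeasurableSpace X]
    [BorelSpace X] (x₀ : X) (φ : ℝ → EReal) (hφ : MoreauYosida.IsDivergenceFunction φ)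
    (lam α : ℝ) (hlam : 0 < lam) (hα : 1 ≤ α)
    (μ ν ξ : ProbabilityMeasure X)
    (hξ : MoreauYosida.moreauYosida φ lam α μ ν =
      MoreauYosida.primalObjective φ lam α μ ν ξ) :
    ∃ f : X → ℝ,
      -- `f` is admissible in the dual problem and attains its maximum,
      -- which is the value of the Moreau–Yosida approximation
      f ∈ MoreauYosida.dualFeasible lam α x₀ ∧
      IsMaxOn (MoreauYosida.dualObjective φ lam α μ ν)
        (MoreauYosida.dualFeasible lam α x₀) f ∧
      MoreauYosida.dualObjective φ lam α μ ν f = MoreauYosida.moreauYosida φ lam α μ ν ∧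
      MoreauYosida.IsCsiszarPotential φ ξ ν f ∧
      (∃ k : X → ℝ, MoreauYosida.IsKantorovichPotential μ ξ k ∧
        f = fun x => α * lam * MoreauYosida.W1 μ ξ ^ (α - 1) * k x) ∧
      ((1 < α ∨ μ ≠ ξ) →
        MoreauYosida.lipNorm f = α * lam * MoreauYosida.W1 μ ξ ^ (α - 1)) := by
  exact proposition5_general x₀ φ hφ.convex hφ.proper.2
    (by simp [MoreauYosida.effDom, hφ.map_one]) lam α hlam hα μ ν ξ hξ
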